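/- Fix $n\ge 1$ and a partition $\lambda=(\lambda_1\ge\dots\ge\lambda_n\ge 0)$. Let $R\subseteq\{1,\dots,n-1\}$ be the set of column lengths, other than $n$, of the shape $\lambda$; write $R=\{q_1<\dots<q_r\}$, $q_0:=0$, $q_{r+1}:=n$, and call the intervals $(q_{h-1},q_h]$, $1\le h\le r+1$, carrels. Tuples below are $n$-tuples with entries in $[n]=\{1,\dots,n\}$, ordered entrywise. Let $U$ be the set of upper tuples ($\upsilon_i\ge i$ for all $i$), $UF\subseteq U$ the set of upper flags (weakly increasing upper tuples), and $UI\subseteq U$ the set of upper tuples that strictly increase on each carrel. For $\upsilon,\upsilon'\in U$ write $\upsilon\sim\upsilon'$ if $\{\epsilon\in UI:\epsilon\le\upsilon\}=\{\epsilon\in UI:\epsilon\le\upsilon'\}$. The critical indices of $\upsilon\in U$ are found in each carrel from right to left: the rightmost is the right end $q_h$; to the left of a critical index $x$ the next one is the largest $y<x$ in the same carrel with $\upsilon_x-\upsilon_y>x-y$, if it exists. Let $UGC\subseteq U$ be the set of gapless core tuples, i.e. of those $\eta\in U$ such that, for $1\le h\le r$, $\eta_{q_h}\le\eta_k$ where $k$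 is the leftmost critical index of $\eta$ in the carrel $(q_h,q_{h+1}]$. One has $UF\subseteq UGC\subseteq U$. For $i\in[n]$ let $x(i)$ be the smallest critical index $\ge i$ of the tuple at hand. Define tuples by * core: $\Delta(\upsilon)_i:=\upsilon_{x(i)}-(x(i)-i)$ for $\upsilon\in U$; * canopy: $K(\eta)_i:=\eta_i$ if $i$ is critical, and $:=n$ otherwise, for $\eta\in UGC$; * floor: for $\phi\in UF$, $\underline{\phi}_i:=\max\{\phi_{q_h},\Delta(\phi)_i\}$ if, for some $1\le h\le r$, $i$ lies strictly between $q_h$ and the leftmost critical index of $\phi$ in $(q_h,q_{h+1}]$, and $\underline{\phi}_i:=\Delta(\phi)_i$ otherwise; * ceiling: $\overline{\phi}_i:=\phi_{x(i)}$ for $\phi\in UF$. For $\beta\in U$ let $\mathcal S_\lambda(\beta)$ be the set of semistandard tableaux $T$ of shape $\lambda$ with entries in $[n]$ whose entries in row $i$ are all at most $\beta_i$ (for each $i$), and let $s_\lambda(\beta;x):=\sum_{T\in\mathcal S_\lambda(\beta)}x_1^{\theta_1(T)}\cdots x_n^{\theta_n(T)}$, where $\theta_k(T)$ is the number of entries of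 $T$ equal to $k$. This row bound sum is called a gapless core Schur polynomial if $\beta\in UGC$, and a flag Schur polynomial if $\beta\in UF$. (i) Let $\beta\in U$ and $\eta\in UGC$. If $s_\lambda(\beta;x)=s_\lambda(\eta;x)$, then $\beta\sim\eta$, $\beta\in UGC$, and $\mathcal S_\lambda(\beta)=\mathcal S_\lambda(\eta)$. (ii) Let $\eta\in UGC$. The set of all $\eta'\in UGC$ with $s_\lambda(\eta';x)=s_\lambda(\eta;x)$ is the class $\{\eta'\in UGC:\eta'\sim\eta\}$. This class equals $\{\upsilon\in U:\upsilon\sim\eta\}$ and is the interval $[\Delta(\eta),K(\eta)]$; its minimum is $\Delta(\eta)$ and its maximum is $K(\eta)$. For $\eta,\eta'\in UGC$ the conditions $s_\lambda(\eta;x)=s_\lambda(\eta';x)$, $\eta\sim\eta'$ and $\mathcal S_\lambda(\eta)=\mathcal S_\lambda(\eta')$ are equivalent, and $s_\lambda(\eta;x)\ne s_\lambda(\eta';x)$ if and only if the intervals $[\Delta(\eta),K(\eta)]$ and $[\Delta(\eta'),K(\eta')]$ are disjoint. (iii) Let $\phi\in UF$. The set of all $\phi'\in UF$ with $s_\lambda(\phi';x)=s_\lambda(\phi;x)$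 is the class $\{\phi'\in UF:\phi'\sim\phi\}$. This class is the interval $UF\cap[\underline\phi,\overline\phi]$ of $UF$, with minimum $\underline\phi$ and maximum $\overline\phi$, and it is contained in $[\Delta(\phi),K(\phi)]=\{\upsilon\in U:\upsilon\sim\phi\}\subseteq UGC$. For $\phi,\phi'\in UF$ the conditions $s_\lambda(\phi;x)=s_\lambda(\phi';x)$, $\phi\sim\phi'$ and $\mathcal S_\lambda(\phi)=\mathcal S_\lambda(\phi')$ are equivalent, and $s_\lambda(\phi;x)\ne s_\lambda(\phi';x)$ if and only if the intervals $UF\cap[\underline\phi,\overline\phi]$ and $UF\cap[\underline{\phi'},\overline{\phi'}]$ are disjoint. -/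

import Mathlib

noncomputable section

open scoped Classical

namespace RowBound

/-! ## Tuples

Fix `n ≥ 1`.  An `nn`-tuple is a function `Fin n → Fin n`; the index `i : Fin n` stands for the
`(i+1)`-st index and the entry `v : Fin n` stands for the number `v + 1`.  The entrywise order on
`nn`-tuples is the order of the function type.  A set `R` of dividers `q` (with `1 ≤ q ≤ n - 1`)
cuts `1, ..., n` into carrels; the divider `q` lies just after the `q`-th index. -/

/-- Upper tuples: every entry is at least its index. -/
def U (n : ℕ) : Set (Fin n → Fin n) := {υ | ∀ i, i ≤ υ i}

/-- Upper flags: weakly increasing upper tuples. -/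
def UF (n : ℕ) : Set (Fin n → Fin n) := {φ | φ ∈ U n ∧ Monotone φ}

variable {n : ℕ}

/-- Two indices lie in the same carrel: no divider separates them. -/
def SameCarrel (R : Set ℕ) (i j : Fin n) : Prop := ∀ q ∈ R, (i : ℕ) < q ↔ (j : ℕ) < q

/-- The index is the right end of a carrel. -/
def CarrelEnd (R : Set ℕ) (i : Fin n) : Prop := (i : ℕ) + 1 ∈ R ∨ (i : ℕ) + 1 = n

/-- `R`-increasing upper tuples: upper tuples that strictly increase on each carrel. -/
def UI (R : Set ℕ) : Set (Fin n → Fin n) :=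
  {α | α ∈ U n ∧ ∀ i j, i < j → SameCarrel R i j → α i < α j}

/-- The graph of `υ` between `y` and `x` rises by more than the distance from `y` to `x`. -/
def SteepTo (υ : Fin n → Fin n) (y x : Fin n) : Prop :=
  ((x : ℕ) : ℤ) - ((y : ℕ) : ℤ) < ((υ x : ℕ) : ℤ) - ((υ y : ℕ) : ℤ)

/-- Critical indices of `υ`.  In each carrel the rightmost one is the right end of the carrel; to
the left of a critical index `x`, the next critical index is the largest `y < x` in the carrel of
`x` with `υ x - υ y > x - y`, if there is one. -/
inductive IsCritical (R : Set ℕ) (υ : Fin n → Fin n) : Fin n → Prop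
  | last (x : Fin n) (hx : CarrelEnd R x) : IsCritical R υ x
  | next (x y : Fin n) (hx : IsCritical R υ x) (hyx : y < x) (hc : SameCarrel R y x)
      (hs : SteepTo υ y x) (hmax : ∀ z, y < z → z < x → ¬ SteepTo υ z x) : IsCritical R υ y

/-- Gapless core `R`-tuples: upper tuples such that, for each divider, the entry at the right end
`x` of the carrel before the divider is at most the entry at the leftmost critical index `k` of the
carrel after the divider (equivalently: the entries at the critical indices weakly increase). -/
def UGC (R : Set ℕ) : Set (Fin n → Fin n) :=
  {η | η ∈ U n ∧ ∀ x k, CarrelEnd R x → IsLeast {k | IsCritical R η k ∧ x < k} k → η x ≤ η k}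

/-- `{υ}_R`: the `R`-increasing upper tuples that are entrywise at most `υ`. -/
def below (R : Set ℕ) (υ : Fin n → Fin n) : Set (Fin n → Fin n) := {ε | ε ∈ UI R ∧ ε ≤ υ}

/-- The equivalence relation `υ ∼_R υ'`. -/
def Equi (R : Set ℕ) (υ υ' : Fin n → Fin n) : Prop := below R υ = below R υ'

/-- The equivalence class of `υ` among upper tuples. -/
def classU (R : Set ℕ) (υ : Fin n → Fin n) : Set (Fin n → Fin n) := {υ' | υ' ∈ U n ∧ Equi R υ' υ}

/-- The equivalence class of `η` among gapless core `R`-tuples. -/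
def classG (R : Set ℕ) (η : Fin n → Fin n) : Set (Fin n → Fin n) := {η' | η' ∈ UGC R ∧ Equi R η' η}

/-- The equivalence class of `φ` among upper flags. -/
def classF (R : Set ℕ) (φ : Fin n → Fin n) : Set (Fin n → Fin n) := {φ' | φ' ∈ UF n ∧ Equi R φ' φ}

/-! ## The extreme members of the classes, from the critical pairs -/

lemma exists_critical_ge (R : Set ℕ) (υ : Fin n → Fin n) (i : Fin n) :
    (Finset.univ.filter (fun x => IsCritical R υ x ∧ i ≤ x)).Nonempty := by
  have hi := i.2
  refine ⟨⟨n - 1, by omega⟩, ?_⟩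
  simp only [Finset.mem_filter, Finset.mem_univ, true_and]
  refine ⟨IsCritical.last _ (Or.inr ?_), ?_⟩
  · simp only; omega
  · rw [Fin.le_def]; simp only; omega

/-- The first critical index at or to the right of `i` (it lies in the carrel of `i`). -/
def nextCritical (R : Set ℕ) (υ : Fin n → Fin n) (i : Fin n) : Fin n :=
  (Finset.univ.filter (fun x => IsCritical R υ x ∧ i ≤ x)).min' (exists_critical_ge R υ i)

/-- The `R`-core `Δ_R(υ)`: the entry at `i` is `υ x - (x - i)` where `x` is the first critical
index with `i ≤ x`.  (For upper `υ` we have `υ x ≥ x`, so nothing is truncated.) -/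
def core (R : Set ℕ) (υ : Fin n → Fin n) : Fin n → Fin n := fun i =>
  let x := nextCritical R υ i
  ⟨(υ x : ℕ) - ((x : ℕ) - (i : ℕ)), lt_of_le_of_lt (Nat.sub_le _ _) (υ x).2⟩

/-- The `R`-shell tuple (for gapless core tuples: the `R`-canopy tuple) with the same critical pairs
as `υ`: the critical entries are kept and all other entries are the largest possible number. -/
def canopy [NeZero n] (R : Set ℕ) (υ : Fin n → Fin n) : Fin n → Fin n := fun i =>
  if IsCritical R υ i then υ i else ⊤

/-- The `R`-floor flag with the same critical pairs as `υ`: critical entries are kept; any other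
entry is the one of the `R`-core, except that between the right end `q` of a carrel and the
leftmost critical index of the next carrel it is the maximum of that and the entry at `q`.  (The
supremum is over a set with at most one element `q`; over the empty set it is the least entry.) -/
def floorFlag [NeZero n] (R : Set ℕ) (υ : Fin n → Fin n) : Fin n → Fin n := fun i =>
  if IsCritical R υ i then υ i else
    max ((Finset.univ.filter (fun q => CarrelEnd R q ∧ q < i ∧
      ∀ z, q < z → z < i → ¬ IsCritical R υ z)).sup υ) (core R υ i)

/-- The `R`-ceiling flag with the same critical pairs as `υ`: the entry at `i` is the entry at the
first critical index `x` with `i ≤ x`. -/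
def ceilingFlag (R : Set ℕ) (υ : Fin n → Fin n) : Fin n → Fin n := fun i => υ (nextCritical R υ i)

/-! ## Tableaux and polynomials

A partition is a weakly decreasing `lam : Fin n → ℕ`; the boxes of its shape are the pairs
`(i, j)` with `j < lam i` (row `i`, column `j`, both counted from `0`). -/

/-- The length of column `j` of the shape. -/
def colLen (lam : Fin n → ℕ) (j : ℕ) : ℕ := (Finset.univ.filter (fun i => j < lam i)).card

/-- `R_λ`: the set of the column lengths of the shape other than `n`. -/
def dividers (lam : Fin n → ℕ) : Set ℕ :=
  {q | q ≠ n ∧ ∃ j, (∃ i, j < lam i) ∧ colLen lam j = q}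

/-- Semistandard fillings: weakly increasing along rows, strictly increasing down columns. -/
def IsTableau (lam : Fin n → ℕ) (T : (i : Fin n) → Fin (lam i) → Fin n) : Prop :=
  (∀ i, Monotone (T i)) ∧
  ∀ (i i' : Fin n) (j : ℕ) (h : j < lam i) (h' : j < lam i'), i < i' → T i ⟨j, h⟩ < T i' ⟨j, h'⟩

/-- The row bound tableau set `S_λ(β)`.  The first condition on `β` is the row bound on the latent
column, whose `i`-th entry is `i`; it holds for each upper `β`. -/
def tableaux (lam : Fin n → ℕ) (β : Fin n → Fin n) :
    Finset ((i : Fin n) → Fin (lam i) → Fin n) :=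
  Finset.univ.filter (fun T => IsTableau lam T ∧ (∀ i, i ≤ β i) ∧ ∀ i j, T i j ≤ β i)

/-- The content of a filling: the number of boxes with value `k`. -/
def content {lam : Fin n → ℕ} (T : (i : Fin n) → Fin (lam i) → Fin n) (k : Fin n) : ℕ :=
  (Finset.univ.filter (fun b : (Σ i : Fin n, Fin (lam i)) => T b.1 b.2 = k)).card

/-- The row bound sum `s_λ(β; x)`, a polynomial in `x_1, ..., x_n`.  It is a gapless core Schur
polynomial if `β` is a gapless core tuple, and a flag Schur polynomial if `β` is an upper flag. -/
def rowBoundSum (lam : Fin n → ℕ) (β : Fin n → Fin n) : MvPolynomial (Fin n) ℤ :=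
  ∑ T ∈ tableaux lam β, ∏ k, MvPolynomial.X k ^ content T k

end RowBound

end

/-! ### Carrels, critical indices and cores. -/

namespace RowBound

variable {n : ℕ} {R : Set ℕ} {υ υ' ε φ φ' η : Fin n → Fin n}

/-! Call `υ i - i` the rise of `υ` at `i`. An index is critical exactly when its rise is strictly
below all later rises in its carrel (`isCritical_iff`), so the rise of the core at `i` is the least
rise of `υ` from `i` to the end of the carrel. Hence the core is the largest `R`-increasing upper
tuple below `υ`, and `∼` means equality of cores (`equi_iff`). The core remembers the critical
indices and their entries, and these determine the class: bounds at critical indices suffice, which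
gives the intervals.

For tableaux, the rows of a carrel have equal length, so strictness down columns turns the bound `β`
into the bound `core β`; thus `tableaux lam β` depends only on the core. Conversely `maxTableau lam
η` lies in `tableaux lam β` only if `core η ≤ core β` (`core_le_of_maxTableau_mem`).

Gaplessness enters through `maxTableau_nested`: the columns of `maxTableau lam η` are nested as
sets, and such a tableau is the only one of its shape and content (`IsTableau.eq_of_content_eq`). If
the two sums agree, some tableau bounded by `β` has this content, hence is `maxTableau lam η`; so
the tableau set of `η` is contained in that of `β`. Setting all variables to `1` shows that the sets
have equal size, so they coincide, and so do the cores. -/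

lemma SameCarrel.symm {i j : Fin n} (h : SameCarrel R i j) : SameCarrel R j i :=
  fun q hq => (h q hq).symm

lemma SameCarrel.trans {i j k : Fin n} (h : SameCarrel R i j) (h' : SameCarrel R j k) :
    SameCarrel R i k := fun q hq => (h q hq).trans (h' q hq)

lemma SameCarrel.of_between {i z j : Fin n} (h : SameCarrel R i j) (hi : i ≤ z) (hj : z ≤ j) :
    SameCarrel R i z := by
  intro q hq
  have := h q hq
  rw [Fin.le_def] at hi hj
  omega

lemma CarrelEnd.not_sameCarrel {x z : Fin n} (hx : CarrelEnd R x) (hz : x < z) :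
    ¬ SameCarrel R x z := by
  intro h
  rw [Fin.lt_def] at hz
  rcases hx with hx | hx
  · have := h _ hx
    omega
  · omega

lemma exists_carrelEnd (R : Set ℕ) (i : Fin n) :
    ∃ e, i ≤ e ∧ CarrelEnd R e ∧ SameCarrel R i e := by
  classical
  have hi := i.2
  obtain ⟨e, he, hmin⟩ := Finset.exists_min_image
    (Finset.univ.filter fun e : Fin n => i ≤ e ∧ CarrelEnd R e) id
    ⟨⟨n - 1, by omega⟩, by
      simp only [Finset.mem_filter, Finset.mem_univ, true_and, Fin.le_def]
      exact ⟨by omega, Or.inr (by simp only; omega)⟩⟩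
  simp only [Finset.mem_filter, Finset.mem_univ, true_and, id] at he hmin
  refine ⟨e, he.1, he.2, fun q hq => ⟨fun hiq => ?_, fun h => lt_of_le_of_lt he.1 h⟩⟩
  by_contra hlt
  have he2 := e.2
  -- A divider `q` with `i < q ≤ e` would make `q - 1` an earlier carrel end.
  have h := hmin ⟨q - 1, by omega⟩
    ⟨by rw [Fin.le_def]; simp only; omega, Or.inl (by
      have : q - 1 + 1 = q := by omega
      simpa [this] using hq)⟩
  rw [Fin.le_def] at h
  simp only at h
  omega

/-- The rightmost index in `[y, x)` of smaller rise than `x` is the next critical index. Rises are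
compared additively, which avoids truncated subtraction. -/
lemma exists_critical_of_rise_lt {x y : Fin n} (hx : IsCritical R υ x) (hyx : y < x)
    (hc : SameCarrel R y x) (h : (υ y : ℕ) + x < υ x + y) :
    ∃ c, IsCritical R υ c ∧ y ≤ c ∧ c < x := by
  classical
  obtain ⟨z, hz, hmax⟩ := Finset.exists_max_image
    (Finset.univ.filter fun z : Fin n => y ≤ z ∧ z < x ∧ (υ z : ℕ) + x < υ x + z) id
    ⟨y, by simp [hyx, h]⟩
  simp only [Finset.mem_filter, Finset.mem_univ, true_and, id] at hz hmax
  refine ⟨z, ?_, hz.1, hz.2.1⟩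
  refine .next x z hx hz.2.1 ?_ ?_ ?_
  · exact (hc.of_between hz.1 hz.2.1.le).symm.trans hc
  · have := hz.2.2
    unfold SteepTo
    omega
  · intro w hw hwx hs
    unfold SteepTo at hs
    exact absurd (hmax w ⟨hz.1.trans hw.le, hwx, by omega⟩) (not_le.2 hw)

open scoped Classical in
lemma nextCritical_mem (R : Set ℕ) (υ : Fin n → Fin n) (i : Fin n) :
    IsCritical R υ (nextCritical R υ i) ∧ i ≤ nextCritical R υ i :=
  (Finset.mem_filter.1 (Finset.min'_mem _ (exists_critical_ge R υ i))).2

lemma isCritical_nextCritical (R : Set ℕ) (υ : Fin n → Fin n) (i : Fin n) :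
    IsCritical R υ (nextCritical R υ i) := (nextCritical_mem R υ i).1

lemma le_nextCritical (R : Set ℕ) (υ : Fin n → Fin n) (i : Fin n) :
    i ≤ nextCritical R υ i := (nextCritical_mem R υ i).2

lemma nextCritical_le {i x : Fin n} (hx : IsCritical R υ x) (hi : i ≤ x) :
    nextCritical R υ i ≤ x :=
  Finset.min'_le _ _ (by simp [hx, hi])

lemma nextCritical_eq_self {i : Fin n} (hi : IsCritical R υ i) : nextCritical R υ i = i :=
  le_antisymm (nextCritical_le hi le_rfl) (le_nextCritical R υ i)

lemma nextCritical_mono {i j : Fin n} (h : i ≤ j) : nextCritical R υ i ≤ nextCritical R υ j :=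
  nextCritical_le (isCritical_nextCritical R υ j) (h.trans (le_nextCritical R υ j))

lemma sameCarrel_nextCritical (R : Set ℕ) (υ : Fin n → Fin n) (i : Fin n) :
    SameCarrel R i (nextCritical R υ i) := by
  obtain ⟨e, hie, he, hc⟩ := exists_carrelEnd R i
  exact hc.of_between (le_nextCritical R υ i) (nextCritical_le (.last e he) hie)

lemma IsCritical.rise_lt {x : Fin n} (hx : IsCritical R υ x) {z : Fin n} (hz : x < z)
    (hc : SameCarrel R x z) : (υ x : ℕ) + z < υ z + x := by
  induction hx generalizing z with
  | last x hx => exact absurd hc (hx.not_sameCarrel hz)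
  | next x y hx hyx hcx hs hmax ih =>
    unfold SteepTo at hs hmax
    rcases lt_trichotomy z x with h | rfl | h
    · have := hmax z hz h
      omega
    · omega
    · have := ih h (hcx.symm.trans hc)
      omega

/-- Replaces the right-to-left recursion by a direct criterion: the rise at `y` is strictly below
every later rise in its carrel. -/
lemma isCritical_iff {y : Fin n} : IsCritical R υ y ↔
    ∀ z, y < z → SameCarrel R y z → (υ y : ℕ) + z < υ z + y := by
  refine ⟨fun h z hz hc => h.rise_lt hz hc, fun h => ?_⟩
  rcases (le_nextCritical R υ y).eq_or_lt with heq | hlt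
  · exact heq ▸ isCritical_nextCritical R υ y
  · have hc := sameCarrel_nextCritical R υ y
    obtain ⟨c, hcr, hyc, hcx⟩ := exists_critical_of_rise_lt (isCritical_nextCritical R υ y) hlt hc
      (h _ hlt hc)
    exact absurd (nextCritical_le hcr hyc) (not_le.2 hcx)

/-- The rise of `υ` at the first critical index from `i` is the least one from `i` to the right
end of the carrel. -/
lemma rise_nextCritical_le {i z : Fin n} (hi : i ≤ z) (hc : SameCarrel R i z) :
    (υ (nextCritical R υ i) : ℕ) + z ≤ υ z + nextCritical R υ i := by
  have hx := isCritical_nextCritical R υ i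
  have hcx := hc.symm.trans (sameCarrel_nextCritical R υ i)
  rcases lt_trichotomy z (nextCritical R υ i) with h | h | h
  · by_contra hlt
    obtain ⟨c, hcr, hyc, hcx⟩ := exists_critical_of_rise_lt hx h hcx (by omega)
    exact absurd (nextCritical_le hcr (hi.trans hyc)) (not_le.2 hcx)
  · rw [← h]
  · exact (hx.rise_lt h hcx.symm).le

lemma core_val (hυ : υ ∈ U n) (i : Fin n) :
    (core R υ i : ℕ) + nextCritical R υ i = υ (nextCritical R υ i) + i := by
  have h1 := le_nextCritical R υ i
  have h2 := hυ (nextCritical R υ i)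
  rw [Fin.le_def] at h1 h2
  simp only [core]
  omega

lemma core_le (hυ : υ ∈ U n) : core R υ ≤ υ := by
  intro i
  have h1 := core_val (R := R) hυ i
  have h2 := rise_nextCritical_le (R := R) (υ := υ) (le_refl i) (fun _ _ => Iff.rfl)
  rw [Fin.le_def]
  omega

lemma core_of_isCritical {i : Fin n} (hi : IsCritical R υ i) : core R υ i = υ i := by
  apply Fin.ext
  simp [core, nextCritical_eq_self hi]

lemma core_mem_UI (hυ : υ ∈ U n) : core R υ ∈ UI R := by
  refine ⟨fun i => ?_, fun i j hij hc => ?_⟩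
  · have h1 := core_val (R := R) hυ i
    have h2 := hυ (nextCritical R υ i)
    rw [Fin.le_def] at h2 ⊢
    omega
  · have h1 := core_val (R := R) hυ i
    have h2 := core_val (R := R) hυ j
    have h3 := rise_nextCritical_le (R := R) (υ := υ) (hij.le.trans (le_nextCritical R υ j))
      (hc.trans (sameCarrel_nextCritical R υ j))
    rw [Fin.lt_def] at hij ⊢
    omega

lemma UI_spread (hε : ε ∈ UI R) {i j : Fin n} (hij : i ≤ j) (hc : SameCarrel R i j) :
    (ε i : ℕ) + j ≤ ε j + i := by
  obtain ⟨j, hj⟩ := j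
  induction j with
  | zero =>
    have : i = ⟨0, hj⟩ := le_antisymm hij (Nat.zero_le _)
    rw [this]
  | succ j ih =>
    rcases hij.eq_or_lt with h | h
    · rw [h]
    · have h' : i ≤ (⟨j, by omega⟩ : Fin n) := by
        rw [Fin.lt_def] at h; rw [Fin.le_def]; simp only at h ⊢; omega
      have hlt : (⟨j, by omega⟩ : Fin n) < ⟨j + 1, hj⟩ := by rw [Fin.lt_def]; simp
      have hc' := hc.of_between h' hlt.le
      have h1 := ih (by omega) h' hc'
      have h2 := hε.2 _ _ hlt (hc'.symm.trans hc)
      rw [Fin.lt_def] at h2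
      simp only at h1 h2 ⊢
      omega

/-- An `R`-increasing tuple is below the core as soon as it is bounded at the critical indices. -/
lemma le_core_of_critical (hυ : υ ∈ U n) (hε : ε ∈ UI R)
    (h : ∀ x, IsCritical R υ x → ε x ≤ υ x) : ε ≤ core R υ := by
  intro i
  have h1 := core_val (R := R) hυ i
  have h2 := UI_spread hε (le_nextCritical R υ i) (sameCarrel_nextCritical R υ i)
  have h3 := h _ (isCritical_nextCritical R υ i)
  rw [Fin.le_def] at h3 ⊢
  omega

lemma le_core (hυ : υ ∈ U n) (hε : ε ∈ UI R) (h : ε ≤ υ) : ε ≤ core R υ :=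
  le_core_of_critical hυ hε fun x _ => h x

/-- The core is the maximum of `below R υ`, so each determines the other. -/
lemma equi_iff (hυ : υ ∈ U n) (hυ' : υ' ∈ U n) : Equi R υ υ' ↔ core R υ = core R υ' := by
  constructor
  · intro h
    have h1 : core R υ ∈ below R υ' := h ▸ ⟨core_mem_UI hυ, core_le hυ⟩
    have h2 : core R υ' ∈ below R υ :=
      (show below R υ = below R υ' from h) ▸ ⟨core_mem_UI hυ', core_le hυ'⟩
    exact le_antisymm (le_core hυ' h1.1 h1.2) (le_core hυ h2.1 h2.2)
  · intro h
    apply Set.ext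
    intro ε
    exact ⟨fun hε => ⟨hε.1, (le_core hυ hε.1 hε.2).trans (h ▸ core_le hυ')⟩,
      fun hε => ⟨hε.1, (le_core hυ' hε.1 hε.2).trans (h ▸ core_le hυ)⟩⟩

/-- The rise of the core is constant from `i` to the next critical index of `υ`, so no new critical
index appears; the old ones keep their entries and stay strict minima. -/
lemma isCritical_core (hυ : υ ∈ U n) {i : Fin n} :
    IsCritical R (core R υ) i ↔ IsCritical R υ i := by
  constructor
  · intro h
    rcases (le_nextCritical R υ i).eq_or_lt with heq | hlt
    · exact heq ▸ isCritical_nextCritical R υ i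
    · have h1 := h.rise_lt hlt (sameCarrel_nextCritical R υ i)
      rw [core_of_isCritical (isCritical_nextCritical R υ i)] at h1
      have := core_val (R := R) hυ i
      omega
  · intro h
    rw [isCritical_iff]
    intro z hz hc
    have h1 := h.rise_lt (hz.trans_le (le_nextCritical R υ z))
      (hc.trans (sameCarrel_nextCritical R υ z))
    have h2 := core_val (R := R) hυ z
    rw [core_of_isCritical h]
    omega

lemma isCritical_congr (hυ : υ ∈ U n) (hυ' : υ' ∈ U n) (h : core R υ = core R υ') {i : Fin n} :
    IsCritical R υ i ↔ IsCritical R υ' i := by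
  rw [← isCritical_core hυ, h, isCritical_core hυ']

lemma apply_eq_of_core_eq (hυ : υ ∈ U n) (hυ' : υ' ∈ U n) (h : core R υ = core R υ') {i : Fin n}
    (hi : IsCritical R υ i) : υ i = υ' i := by
  rw [← core_of_isCritical hi, h, core_of_isCritical ((isCritical_congr hυ hυ' h).1 hi)]

lemma UGC_of_core_eq (hυ : υ ∈ U n) (hη : η ∈ UGC R) (h : core R υ = core R η) : υ ∈ UGC R := by
  refine ⟨hυ, fun x k hx hk => ?_⟩
  rw [apply_eq_of_core_eq hυ hη.1 h (.last x hx), apply_eq_of_core_eq hυ hη.1 h hk.1.1]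
  simp only [isCritical_congr hυ hη.1 h] at hk
  exact hη.2 x k hx hk

lemma UF_subset_UGC (hφ : φ ∈ UF n) : φ ∈ UGC R :=
  ⟨hφ.1, fun _ _ _ hk => hφ.2 hk.1.2.le⟩

/-- The entries of a gapless core tuple at its critical indices weakly increase. -/
lemma UGC.critical_mono (hη : η ∈ UGC R) {x y : Fin n} (hx : IsCritical R η x)
    (hy : IsCritical R η y) (hxy : x ≤ y) : η x ≤ η y := by
  classical
  induction hd : (y : ℕ) - x using Nat.strong_induction_on generalizing x with
  | _ d ih =>
  rcases hxy.eq_or_lt with rfl | hlt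
  · exact le_rfl
  obtain ⟨k, hk, hmin⟩ := Finset.exists_min_image
    (Finset.univ.filter fun k : Fin n => IsCritical R η k ∧ x < k) id ⟨y, by simp [hy, hlt]⟩
  simp only [Finset.mem_filter, Finset.mem_univ, true_and, id] at hk hmin
  have hky : k ≤ y := hmin y ⟨hy, hlt⟩
  have hxk := hk.2
  have h1 : η k ≤ η y := by
    refine ih _ ?_ hk.1 hky rfl
    rw [Fin.le_def] at hky
    rw [Fin.lt_def] at hxk
    omega
  refine le_trans ?_ h1
  by_cases he : CarrelEnd R x
  · exact hη.2 x k he ⟨hk, fun z hz => hmin z hz⟩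
  -- Here `k` is in the carrel of `x`, where critical rises, hence entries, strictly increase.
  · obtain ⟨e, hxe, he', hc⟩ := exists_carrelEnd R x
    have hxe' : x < e := lt_of_le_of_ne hxe (by rintro rfl; exact he he')
    have := hx.rise_lt hxk (hc.of_between hxk.le (hmin e ⟨.last e he', hxe'⟩))
    rw [Fin.lt_def] at hxk
    rw [Fin.le_def]
    omega

lemma classG_eq_classU (hη : η ∈ UGC R) : classG R η = classU R η := by
  apply Set.ext
  intro υ
  exact ⟨fun h => ⟨h.1.1, h.2⟩,
    fun h => ⟨UGC_of_core_eq h.1 hη ((equi_iff h.1 hη.1).1 h.2), h.2⟩⟩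

lemma classU_subset_UGC (hη : η ∈ UGC R) : classU R η ⊆ UGC R :=
  classG_eq_classU hη ▸ fun _ h => h.1

lemma ceilingFlag_mem_UF (hφ : φ ∈ UF n) : ceilingFlag R φ ∈ UF n :=
  ⟨fun i => (hφ.1 i).trans (hφ.2 (le_nextCritical R φ i)), fun _ _ h => hφ.2 (nextCritical_mono h)⟩

/-! ### Classes as intervals of upper tuples and of upper flags. -/

section NeZero
variable [NeZero n]

lemma le_canopy_of_core_eq (hυ : υ ∈ U n) (hυ' : υ' ∈ U n) (h : core R υ' = core R υ) :
    υ' ≤ canopy R υ := by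
  intro i
  by_cases hi : IsCritical R υ i
  · simp only [canopy, if_pos hi]
    exact (apply_eq_of_core_eq hυ hυ' h.symm hi).ge
  · simp only [canopy, if_neg hi]
    exact le_top

lemma classU_eq_Icc (hυ : υ ∈ U n) : classU R υ = Set.Icc (core R υ) (canopy R υ) := by
  apply Set.ext
  intro υ'
  constructor
  · rintro ⟨hυ', h⟩
    rw [equi_iff hυ' hυ] at h
    exact ⟨h ▸ core_le hυ', le_canopy_of_core_eq hυ hυ' h⟩
  · rintro ⟨h1, h2⟩
    have hυ' : υ' ∈ U n := fun i => ((core_mem_UI hυ).1 i).trans (h1 i)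
    refine ⟨hυ', (equi_iff hυ' hυ).2 (le_antisymm ?_ (le_core hυ' (core_mem_UI hυ) h1))⟩
    -- The canopy bounds `υ'` only at the critical indices of `υ`, which is enough.
    refine le_core_of_critical hυ (core_mem_UI hυ') fun x hx => ?_
    have h3 := h2 x
    simp only [canopy, if_pos hx] at h3
    exact (core_le hυ' x).trans h3

lemma core_le_canopy (hυ : υ ∈ U n) : core R υ ≤ canopy R υ :=
  (core_le hυ).trans (le_canopy_of_core_eq hυ hυ rfl)

/-- For an upper flag the case distinction in the floor is redundant. -/
lemma floorFlag_le_iff (hφ : φ ∈ UF n) {i v : Fin n} : floorFlag R φ i ≤ v ↔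
    (∀ q, CarrelEnd R q → q < i → (∀ z, q < z → z < i → ¬ IsCritical R φ z) → φ q ≤ v) ∧
      core R φ i ≤ v := by
  by_cases hi : IsCritical R φ i
  · simp only [floorFlag, if_pos hi, core_of_isCritical hi]
    exact ⟨fun h => ⟨fun q _ hq _ => (hφ.2 hq.le).trans h, h⟩, fun h => h.2⟩
  · simp only [floorFlag, if_neg hi, max_le_iff, Finset.sup_le_iff, Finset.mem_filter,
      Finset.mem_univ, true_and, and_imp]

lemma floorFlag_mono (hφ : φ ∈ UF n) : Monotone (floorFlag R φ) := by
  classical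
  intro i j hij
  have hj := (floorFlag_le_iff (R := R) hφ).1 (le_refl (floorFlag R φ j))
  rw [floorFlag_le_iff hφ]
  rcases hij.eq_or_lt with rfl | hlt
  · exact hj
  by_cases hcr : ∃ c, IsCritical R φ c ∧ i ≤ c ∧ c < j
  · obtain ⟨c, hc, hmax⟩ := Finset.exists_max_image
      (Finset.univ.filter fun c : Fin n => IsCritical R φ c ∧ i ≤ c ∧ c < j) id
      (hcr.imp fun c hc => by simp [hc])
    simp only [Finset.mem_filter, Finset.mem_univ, true_and, id] at hc hmax
    obtain ⟨hc, hic, hcj⟩ := hc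
    -- `c` is the last critical index in `[i, j)`. If it ends its carrel, the floor at `j` takes `φ
    -- c` into account; otherwise `j` is in the carrel of `c`, where the core strictly increases.
    have key : φ c ≤ floorFlag R φ j := by
      by_cases he : CarrelEnd R c
      · exact hj.1 c he hcj fun z hcz hzj hz =>
          absurd (hmax z ⟨hz, hic.trans hcz.le, hzj⟩) (not_le.2 hcz)
      · obtain ⟨e, hce, he', hsc⟩ := exists_carrelEnd R c
        have hje : j ≤ e := by
          by_contra hlt'
          exact he (le_antisymm hce (hmax e ⟨.last e he', hic.trans hce, not_le.1 hlt'⟩) ▸ he')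
        have := (core_mem_UI hφ.1).2 c j hcj (hsc.of_between hcj.le hje)
        rw [core_of_isCritical hc] at this
        exact this.le.trans hj.2
    refine ⟨fun q _ hq _ => (hφ.2 (hq.le.trans hic)).trans key, ?_⟩
    exact ((core_le hφ.1 i).trans (hφ.2 hic)).trans key
  · have hno : ∀ z, i ≤ z → z < j → ¬ IsCritical R φ z := fun z h1 h2 hz => hcr ⟨z, hz, h1, h2⟩
    refine ⟨fun q hq hqi hz => hj.1 q hq (hqi.trans hlt) fun z hqz hzj => ?_, ?_⟩
    · rcases lt_or_ge z i with h | h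
      · exact hz z hqz h
      · exact hno z h hzj
    · have hx : nextCritical R φ i = nextCritical R φ j := by
        refine le_antisymm (nextCritical_mono hij) (nextCritical_le (isCritical_nextCritical R φ i) ?_)
        by_contra h
        exact hno _ (le_nextCritical R φ i) (not_le.1 h) (isCritical_nextCritical R φ i)
      have h1 := core_val (R := R) hφ.1 i
      have h2 := core_val (R := R) hφ.1 j
      rw [hx] at h1
      refine le_trans ?_ hj.2
      rw [Fin.lt_def] at hlt
      rw [Fin.le_def]
      omega

lemma core_le_floorFlag (hφ : φ ∈ UF n) : core R φ ≤ floorFlag R φ := fun _ =>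
  ((floorFlag_le_iff hφ).1 le_rfl).2

lemma floorFlag_mem_UF (hφ : φ ∈ UF n) : floorFlag R φ ∈ UF n :=
  ⟨fun i => ((core_mem_UI hφ.1).1 i).trans (core_le_floorFlag (R := R) hφ i), floorFlag_mono hφ⟩

/-- Both flags agree at the critical indices; monotonicity of `φ'` carries the entry at a carrel end
to the right and bounds `φ'` by the next critical entry. -/
lemma mem_Icc_floorFlag_ceilingFlag (hφ : φ ∈ UF n) (hφ' : φ' ∈ UF n)
    (h : core R φ' = core R φ) : φ' ∈ Set.Icc (floorFlag R φ) (ceilingFlag R φ) := by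
  refine ⟨fun i => (floorFlag_le_iff hφ).2 ⟨fun q hq hqi _ => ?_, ?_⟩, fun i => ?_⟩
  · rw [apply_eq_of_core_eq hφ.1 hφ'.1 h.symm (.last q hq)]
    exact hφ'.2 hqi.le
  · exact h ▸ core_le hφ'.1 i
  · rw [ceilingFlag, apply_eq_of_core_eq hφ.1 hφ'.1 h.symm (isCritical_nextCritical R φ i)]
    exact hφ'.2 (le_nextCritical R φ i)

lemma ceilingFlag_le_canopy : ceilingFlag R φ ≤ canopy R φ := by
  intro i
  by_cases hi : IsCritical R φ i
  · simp only [canopy, if_pos hi, ceilingFlag, nextCritical_eq_self hi, le_refl]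
  · simp only [canopy, if_neg hi, le_top]

lemma classF_eq (hφ : φ ∈ UF n) :
    classF R φ = UF n ∩ Set.Icc (floorFlag R φ) (ceilingFlag R φ) := by
  apply Set.ext
  intro φ'
  constructor
  · rintro ⟨hφ', h⟩
    exact ⟨hφ', mem_Icc_floorFlag_ceilingFlag hφ hφ' ((equi_iff hφ'.1 hφ.1).1 h)⟩
  · rintro ⟨hφ', h1, h2⟩
    have h : φ' ∈ classU R φ := classU_eq_Icc hφ.1 ▸
      ⟨(core_le_floorFlag hφ).trans h1, h2.trans ceilingFlag_le_canopy⟩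
    exact ⟨hφ', h.2⟩

lemma floorFlag_le_ceilingFlag (hφ : φ ∈ UF n) : floorFlag R φ ≤ ceilingFlag R φ :=
  have h := mem_Icc_floorFlag_ceilingFlag (R := R) hφ hφ rfl
  h.1.trans h.2

end NeZero

end RowBound
namespace RowBound

section Tableaux

variable {n : ℕ} {lam : Fin n → ℕ} {υ β η : Fin n → Fin n}

lemma lt_colLen_iff (hlam : Antitone lam) {i : Fin n} {j : ℕ} :
    (i : ℕ) < colLen lam j ↔ j < lam i := by
  classical
  unfold colLen
  constructor
  · intro h
    by_contra hj
    have hsub : (Finset.univ.filter fun z => j < lam z) ⊆ Finset.Iio i := by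
      intro z hz
      simp only [Finset.mem_filter, Finset.mem_univ, true_and, Finset.mem_Iio] at hz ⊢
      by_contra hiz
      exact hj (hz.trans_le (hlam (not_lt.1 hiz)))
    have := Finset.card_le_card hsub
    rw [Fin.card_Iio] at this
    exact absurd (lt_of_lt_of_le h this) (lt_irrefl _)
  · intro h
    have hsub : Finset.Iic i ⊆ (Finset.univ.filter fun z => j < lam z) := by
      intro z hz
      simp only [Finset.mem_filter, Finset.mem_univ, true_and, Finset.mem_Iic] at hz ⊢
      exact h.trans_le (hlam hz)
    have := Finset.card_le_card hsub
    rw [Fin.card_Iic] at this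
    exact this

lemma colLen_antitone (lam : Fin n → ℕ) : Antitone (colLen lam) := fun _ _ h =>
  Finset.card_le_card fun _ hz => by
    simp only [Finset.mem_filter, Finset.mem_univ, true_and] at hz ⊢
    omega

lemma sameCarrel_iff (hlam : Antitone lam) {i i' : Fin n} :
    SameCarrel (dividers lam) i i' ↔ lam i = lam i' := by
  constructor
  · intro h
    have key : ∀ {a b : Fin n}, SameCarrel (dividers lam) a b → lam a ≤ lam b := by
      intro a b h
      by_contra hlt
      -- Column `lam b` is the first that misses row `b`; if row `a` is longer, the length of this
      -- column is a divider separating them.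
      have ha : (a : ℕ) < colLen lam (lam b) := (lt_colLen_iff hlam).2 (not_le.1 hlt)
      have hb : ¬ (b : ℕ) < colLen lam (lam b) := fun h => lt_irrefl _ ((lt_colLen_iff hlam).1 h)
      exact hb ((h _ ⟨fun hn => hb (by rw [hn]; exact b.2), lam b, ⟨a, not_le.1 hlt⟩, rfl⟩).1 ha)
    exact le_antisymm (key h) (key h.symm)
  · rintro h q ⟨_, j, _, rfl⟩
    rw [lt_colLen_iff hlam, lt_colLen_iff hlam, h]

lemma mem_tableaux (hβ : β ∈ U n) {T : (i : Fin n) → Fin (lam i) → Fin n} :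
    T ∈ tableaux lam β ↔ IsTableau lam T ∧ ∀ i j, T i j ≤ β i := by
  simp only [tableaux, Finset.mem_filter, Finset.mem_univ, true_and]
  exact ⟨fun h => ⟨h.1, h.2.2⟩, fun h => ⟨h.1, hβ, h.2⟩⟩

lemma IsTableau.spread (hlam : Antitone lam) {T : (i : Fin n) → Fin (lam i) → Fin n}
    (hT : IsTableau lam T) {i i' : Fin n} (hii' : i ≤ i') {j : ℕ} (h : j < lam i)
    (h' : j < lam i') : (T i ⟨j, h⟩ : ℕ) + i' ≤ T i' ⟨j, h'⟩ + i := by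
  obtain ⟨m, hm⟩ := i'
  induction m with
  | zero =>
    have : i = ⟨0, hm⟩ := le_antisymm hii' (Nat.zero_le _)
    subst this
    exact le_rfl
  | succ m ih =>
    rcases hii'.eq_or_lt with heq | hlt
    · subst heq
      exact le_rfl
    · have h1 : i ≤ (⟨m, by omega⟩ : Fin n) := by
        rw [Fin.lt_def] at hlt; rw [Fin.le_def]; simp only at hlt ⊢; omega
      have h2 : (⟨m, by omega⟩ : Fin n) < ⟨m + 1, hm⟩ := by rw [Fin.lt_def]; simp
      have h3 : j < lam ⟨m, by omega⟩ := h'.trans_le (hlam h2.le)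
      have h4 := ih (by omega) h1 h3
      have h5 := hT.2 _ _ j h3 h' h2
      rw [Fin.lt_def] at h5
      simp only at h4 h5 ⊢
      omega

/-- Column `j` reaches the next critical row, since that row has the same length; strictness then
carries its bound back up to row `i`. -/
lemma IsTableau.le_core (hlam : Antitone lam) {T : (i : Fin n) → Fin (lam i) → Fin n}
    (hT : IsTableau lam T) (hβ : β ∈ U n) (h : ∀ i j, T i j ≤ β i) (i : Fin n) (j : Fin (lam i)) :
    T i j ≤ core (dividers lam) β i := by
  have hc := (sameCarrel_iff hlam).1 (sameCarrel_nextCritical (dividers lam) β i)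
  have h1 := hT.spread hlam (le_nextCritical (dividers lam) β i) j.2 (hc.le.trans_lt' j.2)
  have h2 := h _ ⟨j, hc.le.trans_lt' j.2⟩
  have h3 := core_val (R := dividers lam) hβ i
  rw [Fin.le_def] at h2 ⊢
  simp only [Fin.eta] at h1
  omega

lemma tableaux_subset (hlam : Antitone lam) (hβ : β ∈ U n) (hη : η ∈ U n)
    (h : core (dividers lam) η ≤ core (dividers lam) β) : tableaux lam η ⊆ tableaux lam β := by
  intro T hT
  rw [mem_tableaux hη] at hT
  rw [mem_tableaux hβ]
  exact ⟨hT.1, fun i j => (hT.1.le_core hlam hη hT.2 i j).trans ((h i).trans (core_le hβ i))⟩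

lemma tableaux_eq_of_core_eq (hlam : Antitone lam) (hβ : β ∈ U n) (hη : η ∈ U n)
    (h : core (dividers lam) β = core (dividers lam) η) : tableaux lam β = tableaux lam η :=
  Finset.Subset.antisymm (tableaux_subset hlam hη hβ h.le) (tableaux_subset hlam hβ hη h.ge)

/-! ### The largest tableau within a row bound -/

/-- The least rise of `υ` over the indices from `i` up to, but not including, `q`. -/
noncomputable def minRise (υ : Fin n → Fin n) (q i : ℕ) : ℕ :=
  sInf {m | ∃ z : Fin n, i ≤ z ∧ (z : ℕ) < q ∧ (υ z : ℕ) - z = m}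

lemma minRise_le {q i : ℕ} {z : Fin n} (hi : i ≤ z) (hz : (z : ℕ) < q) :
    minRise υ q i ≤ υ z - z := Nat.sInf_le ⟨z, hi, hz, rfl⟩

lemma exists_minRise_eq {q : ℕ} {i : Fin n} (hi : (i : ℕ) < q) :
    ∃ z : Fin n, i ≤ z ∧ (z : ℕ) < q ∧ (υ z : ℕ) - z = minRise υ q i :=
  Nat.sInf_mem (s := {m | ∃ z : Fin n, (i : ℕ) ≤ z ∧ (z : ℕ) < q ∧ (υ z : ℕ) - z = m})
    ⟨_, i, le_rfl, hi, rfl⟩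

/-- The largest tableau whose `i`-th row is bounded by `υ i`. -/
noncomputable def maxTableau (lam : Fin n → ℕ) (υ : Fin n → Fin n) :
    (i : Fin n) → Fin (lam i) → Fin n := fun i j =>
  ⟨min (i + minRise υ (colLen lam j) i) (υ i), lt_of_le_of_lt (min_le_right _ _) (υ i).2⟩

/-- The minimum in `maxTableau` only supplies the `Fin` bound: row `i` itself competes in `minRise`.
-/
lemma maxTableau_val (hlam : Antitone lam) (hυ : υ ∈ U n) (i : Fin n) (j : Fin (lam i)) :
    (maxTableau lam υ i j : ℕ) = i + minRise υ (colLen lam j) i := by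
  have h1 := minRise_le (υ := υ) (le_refl (i : ℕ)) ((lt_colLen_iff hlam).2 j.2)
  have h2 := hυ i
  rw [Fin.le_def] at h2
  simp only [maxTableau]
  omega

lemma maxTableau_mem (hlam : Antitone lam) (hυ : υ ∈ U n) :
    maxTableau lam υ ∈ tableaux lam υ := by
  rw [mem_tableaux hυ]
  refine ⟨⟨fun i j j' hjj' => ?_, fun i i' j h h' hii' => ?_⟩, fun i j => ?_⟩
  · rw [Fin.le_def, maxTableau_val hlam hυ, maxTableau_val hlam hυ]
    obtain ⟨z, hz, hzq, hm⟩ := exists_minRise_eq (υ := υ) ((lt_colLen_iff hlam).2 j'.2)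
    have := minRise_le (υ := υ) hz (hzq.trans_le (colLen_antitone lam hjj'))
    omega
  · rw [Fin.lt_def, maxTableau_val hlam hυ, maxTableau_val hlam hυ]
    obtain ⟨z, hz, hzq, hm⟩ := exists_minRise_eq (υ := υ) ((lt_colLen_iff hlam).2 h')
    have := minRise_le (υ := υ) (hii'.le.trans hz) hzq
    rw [Fin.lt_def] at hii'
    simp only at hm ⊢
    omega
  · rw [Fin.le_def]
    exact min_le_right _ _

lemma core_le_of_maxTableau_mem (hlam : Antitone lam) (hβ : β ∈ U n) (hη : η ∈ U n)
    (h : maxTableau lam η ∈ tableaux lam β) :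
    core (dividers lam) η ≤ core (dividers lam) β := by
  refine le_core hβ (core_mem_UI hη) fun i => ?_
  have hcv := core_val (R := dividers lam) hη i
  -- An empty row carries no box to test, but its carrel reaches the last index, whose rise is `0`,
  -- so the core at `i` is at most `i`. Otherwise the last box of the row is tested: its column ends
  -- with the carrel of `i`.
  rcases Nat.eq_zero_or_pos (lam i) with h0 | hpos
  · have hn := i.2
    have hle : i ≤ (⟨n - 1, by omega⟩ : Fin n) := by
      rw [Fin.le_def]; simp only; omega
    have hl := rise_nextCritical_le (R := dividers lam) (υ := η) hle
      ((sameCarrel_iff hlam).2 (le_antisymm (by omega) (hlam hle)))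
    have h1 := (η ⟨n - 1, by omega⟩).2
    have h2 := hβ i
    rw [Fin.le_def] at h2 ⊢
    simp only at hl
    omega
  · have hj : lam i - 1 < lam i := by omega
    have h1 := ((mem_tableaux hβ).1 h).2 i ⟨lam i - 1, hj⟩
    rw [Fin.le_def, maxTableau_val hlam hη] at h1
    obtain ⟨z, hz, hzq, hm⟩ := exists_minRise_eq (υ := η) ((lt_colLen_iff hlam).2 hj)
    have h2 := rise_nextCritical_le (R := dividers lam) (υ := η) hz
      ((sameCarrel_iff hlam).2 (le_antisymm (by have := (lt_colLen_iff hlam).1 hzq; omega) (hlam hz)))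
    have h3 := hη z
    rw [Fin.le_def] at h3 ⊢
    simp only at h1
    omega

/-- The columns of the largest tableau for a gapless core tuple are nested. -/
lemma maxTableau_nested (hlam : Antitone lam) (hη : η ∈ UGC (dividers lam)) {j j' : ℕ}
    (hjj' : j ≤ j') (i : Fin n) (h : j' < lam i) :
    ∃ (i' : Fin n) (h' : j < lam i'), maxTableau lam η i' ⟨j, h'⟩ = maxTableau lam η i ⟨j', h⟩ := by
  classical
  have hi : (i : ℕ) < colLen lam j' := (lt_colLen_iff hlam).2 h
  have hqq := colLen_antitone lam hjj'
  obtain ⟨w, hw, hwq, hwm⟩ := exists_minRise_eq (υ := η) hi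
  obtain ⟨w', hw', hwq', hwm'⟩ := exists_minRise_eq (υ := η) (hi.trans_le hqq)
  rw [Fin.le_def] at hw hw'
  rcases le_or_gt (minRise η (colLen lam j') i) (minRise η (colLen lam j) i) with hle | hgt
  · refine ⟨i, by omega, Fin.ext ?_⟩
    rw [maxTableau_val hlam hη.1, maxTableau_val hlam hη.1]
    have := minRise_le (υ := η) hw (hwq.trans_le hqq)
    simp only
    omega
  · have hw'q : colLen lam j' ≤ w' := by
      by_contra hlt
      have := minRise_le (υ := η) hw' (not_le.1 hlt)
      omega
    have hne : (Finset.univ.filter fun z : Fin n => colLen lam j' ≤ z ∧ (z : ℕ) < colLen lam j ∧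
        (η z : ℕ) - z = minRise η (colLen lam j) i).Nonempty := ⟨w', by simp [hw'q, hwq', hwm']⟩
    -- The longer column attains its smaller minimal rise only past the end of the shorter one; the
    -- last such index `k` is critical.
    obtain ⟨k, hk, hmax⟩ := Finset.exists_max_image _ id hne
    simp only [Finset.mem_filter, Finset.mem_univ, true_and, id] at hk hmax
    obtain ⟨hk1, hk2, hk3⟩ := hk
    have hkc : IsCritical (dividers lam) η k := by
      rw [isCritical_iff]
      intro z hkz hc
      have hzq : (z : ℕ) < colLen lam j := by
        rw [lt_colLen_iff hlam] at hk2 ⊢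
        rwa [← (sameCarrel_iff hlam).1 hc]
      have h1 := minRise_le (υ := η) (i := i) (z := z) (by rw [Fin.lt_def] at hkz; omega) hzq
      have h2 : (η z : ℕ) - z ≠ minRise η (colLen lam j) i := fun h =>
        absurd (hmax z ⟨by rw [Fin.lt_def] at hkz; omega, hzq, h⟩) (not_le.2 hkz)
      have h3 := hη.1 z
      have h4 := hη.1 k
      rw [Fin.le_def] at h3 h4
      omega
    have hqn : colLen lam j' < n := lt_of_le_of_lt hk1 k.2
    set e : Fin n := ⟨colLen lam j' - 1, by omega⟩ with he
    have hev : (e : ℕ) = colLen lam j' - 1 := rfl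
    have hec : IsCritical (dividers lam) η e :=
      .last e (.inl ⟨by omega, j', ⟨i, h⟩, by omega⟩)
    have hmono := UGC.critical_mono hη hec hkc (by rw [Fin.le_def]; omega)
    have h1 := minRise_le (υ := η) (q := colLen lam j') (i := i) (z := e) (by omega) (by omega)
    have h2 := hη.1 e
    have h3 := hη.1 k
    rw [Fin.le_def] at hmono h2 h3
    have hkn := k.2
    -- The row `i'` is shifted down by the difference of the two minimal rises. Gaplessness `η e ≤ η
    -- k` keeps `i' ≤ k`, so the minimal rise from `i'` is still that at `k` and the entries agree.
    have hi'n : (i : ℕ) + minRise η (colLen lam j') i - minRise η (colLen lam j) i ≤ k := by omega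
    set i' : Fin n := ⟨_, lt_of_le_of_lt hi'n hkn⟩ with hi'
    have hi'v : (i' : ℕ) = (i : ℕ) + minRise η (colLen lam j') i - minRise η (colLen lam j) i := rfl
    have hi'q : (i' : ℕ) < colLen lam j := by omega
    refine ⟨i', (lt_colLen_iff hlam).1 hi'q, Fin.ext ?_⟩
    rw [maxTableau_val hlam hη.1, maxTableau_val hlam hη.1]
    obtain ⟨v, hv, hvq, hvm⟩ := exists_minRise_eq (υ := η) hi'q
    rw [Fin.le_def] at hv
    have h4 := minRise_le (υ := η) (q := colLen lam j) (i := i) (z := v) (by omega) hvq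
    have h5 := minRise_le (υ := η) (q := colLen lam j) (i := i') (z := k) (by omega) hk2
    simp only
    omega

end Tableaux

end RowBound
namespace RowBound

/-! ### Column sets, content and uniqueness. -/

section Columns

variable {n : ℕ} {lam : Fin n → ℕ} {T Y : (i : Fin n) → Fin (lam i) → Fin n}

open scoped Classical in
/-- The set of the entries of column `j`. -/
noncomputable def colSet (T : (i : Fin n) → Fin (lam i) → Fin n) (j : ℕ) : Finset (Fin n) :=
  Finset.univ.filter fun k => ∃ (i : Fin n) (h : j < lam i), T i ⟨j, h⟩ = k

lemma mem_colSet {j : ℕ} {k : Fin n} :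
    k ∈ colSet T j ↔ ∃ (i : Fin n) (h : j < lam i), T i ⟨j, h⟩ = k := by
  simp [colSet]

lemma IsTableau.col_injective (hT : IsTableau lam T) {i i' : Fin n} {j : ℕ} {h : j < lam i}
    {h' : j < lam i'} (he : T i ⟨j, h⟩ = T i' ⟨j, h'⟩) : i = i' := by
  rcases lt_trichotomy i i' with hlt | heq | hlt
  · exact absurd he (hT.2 _ _ _ _ _ hlt).ne
  · exact heq
  · exact absurd he (hT.2 _ _ _ _ _ hlt).ne'

lemma IsTableau.card_colSet (hT : IsTableau lam T) (j : ℕ) :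
    (colSet T j).card = colLen lam j := by
  symm
  refine Finset.card_bij (fun i hi => T i ⟨j, (Finset.mem_filter.1 hi).2⟩) ?_ ?_ ?_
  · intro i hi
    exact mem_colSet.2 ⟨i, _, rfl⟩
  · intro i hi i' hi' h
    exact hT.col_injective h
  · intro k hk
    obtain ⟨i, h, rfl⟩ := mem_colSet.1 hk
    exact ⟨i, by simpa using h, rfl⟩

lemma IsTableau.content_eq (hT : IsTableau lam T) {N : ℕ} (hN : ∀ i, lam i ≤ N) (k : Fin n) :
    content T k = ((Finset.range N).filter fun j => k ∈ colSet T j).card := by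
  refine Finset.card_bij (fun b _ => (b.2 : ℕ)) ?_ ?_ ?_
  · intro b hb
    rw [Finset.mem_filter] at hb ⊢
    exact ⟨Finset.mem_range.2 (b.2.2.trans_le (hN _)), mem_colSet.2 ⟨b.1, b.2.2, hb.2⟩⟩
  · rintro ⟨i, j, hj⟩ hb ⟨i', j', hj'⟩ hb' h
    rw [Finset.mem_filter] at hb hb'
    simp only at h
    subst h
    obtain rfl := hT.col_injective (hb.2.trans hb'.2.symm)
    rfl
  · intro j hj
    rw [Finset.mem_filter] at hj
    obtain ⟨i, h, hk⟩ := mem_colSet.1 hj.2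
    exact ⟨⟨i, j, h⟩, by simpa using hk, rfl⟩

lemma IsTableau.sum_content (hT : IsTableau lam T) {N : ℕ} (hN : ∀ i, lam i ≤ N)
    (A : Finset (Fin n)) :
    ∑ k ∈ A, content T k = ∑ j ∈ Finset.range N, (A ∩ colSet T j).card := by
  simp only [hT.content_eq hN, Finset.card_filter]
  rw [Finset.sum_comm]
  refine Finset.sum_congr rfl fun j _ => ?_
  rw [← Finset.card_filter, Finset.filter_mem_eq_inter]

/-- A tableau is determined by the sets of the entries of its columns. -/
lemma IsTableau.ext_colSet (hT : IsTableau lam T) (hY : IsTableau lam Y)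
    (h : ∀ j, (∃ i, j < lam i) → colSet T j = colSet Y j) : T = Y := by
  have key : ∀ (m : ℕ) (i : Fin n), (i : ℕ) = m → ∀ j (hj : j < lam i),
      T i ⟨j, hj⟩ = Y i ⟨j, hj⟩ := by
    intro m
    induction m using Nat.strong_induction_on with
    | _ m ih =>
    rintro i rfl j hj
    have hjs := h j ⟨i, hj⟩
    apply le_antisymm
    · obtain ⟨i', h', he⟩ := mem_colSet.1 (hjs ▸ mem_colSet.2 ⟨i, hj, rfl⟩ : Y i ⟨j, hj⟩ ∈ colSet T j)
      rcases lt_trichotomy i' i with hlt | rfl | hlt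
      · exact absurd ((ih i' hlt i' rfl j h').symm.trans he) (hY.2 _ _ _ _ _ hlt).ne
      · exact he.le
      · exact he ▸ (hT.2 _ _ _ _ _ hlt).le
    · obtain ⟨i', h', he⟩ := mem_colSet.1 (hjs ▸ mem_colSet.2 ⟨i, hj, rfl⟩ : T i ⟨j, hj⟩ ∈ colSet Y j)
      rcases lt_trichotomy i' i with hlt | rfl | hlt
      · exact absurd ((ih i' hlt i' rfl j h').trans he) (hT.2 _ _ _ _ _ hlt).ne
      · exact he.le
      · exact he ▸ (hY.2 _ _ _ _ _ hlt).le
  funext i j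
  exact key i i rfl j j.2

/-- A tableau with nested columns is the only one of its shape and content. -/
lemma IsTableau.eq_of_content_eq (hT : IsTableau lam T) (hY : IsTableau lam Y)
    (hnest : ∀ j j', j ≤ j' → colSet Y j' ⊆ colSet Y j) (h : content T = content Y) : T = Y := by
  have hN : ∀ i, lam i ≤ ∑ i, lam i := fun i =>
    Finset.single_le_sum (f := lam) (fun _ _ => Nat.zero_le _) (Finset.mem_univ i)
  refine hT.ext_colSet hY fun j ⟨i, hji⟩ => ?_
  have hsum := hT.sum_content hN (colSet Y j)
  rw [h, hY.sum_content hN] at hsum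
  -- An intersection is at most as large as either set; nestedness makes `Y` attain this bound in
  -- every column. Equal content equates the sums, hence every term, and the term at `j` gives the
  -- claim.
  have hle : ∀ j' ∈ Finset.range (∑ i, lam i),
      (colSet Y j ∩ colSet T j').card ≤ (colSet Y j ∩ colSet Y j').card := by
    intro j' _
    rcases le_total j j' with hjj | hjj
    · rw [Finset.inter_eq_right.2 (hnest _ _ hjj), hY.card_colSet, ← hT.card_colSet]
      exact Finset.card_le_card Finset.inter_subset_right
    · rw [Finset.inter_eq_left.2 (hnest _ _ hjj)]
      exact Finset.card_le_card Finset.inter_subset_left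
  have heq := (Finset.sum_eq_sum_iff_of_le hle).1 hsum.symm j
    (Finset.mem_range.2 (hji.trans_le (hN i)))
  rw [Finset.inter_self] at heq
  have h1 : colSet Y j ⊆ colSet T j := Finset.inter_eq_left.1
    (Finset.eq_of_subset_of_card_le Finset.inter_subset_left heq.ge)
  exact (Finset.eq_of_subset_of_card_le h1 (by rw [hT.card_colSet, hY.card_colSet])).symm

end Columns

/-! ### From row bound sums back to cores. -/

section Polynomial

variable {n : ℕ} {lam : Fin n → ℕ} {β η : Fin n → Fin n}

lemma coeff_rowBoundSum (lam : Fin n → ℕ) (β : Fin n → Fin n) (c : Fin n → ℕ) :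
    (rowBoundSum lam β).coeff (Finsupp.equivFunOnFinite.symm c) =
      ((tableaux lam β).filter fun T => content T = c).card := by
  classical
  have hmon : ∀ T : (i : Fin n) → Fin (lam i) → Fin n,
      (∏ k, (MvPolynomial.X k : MvPolynomial (Fin n) ℤ) ^ content T k) =
        MvPolynomial.monomial (Finsupp.equivFunOnFinite.symm (content T)) 1 := by
    intro T
    rw [MvPolynomial.monomial_eq, Finsupp.prod_fintype _ _ (fun _ => pow_zero _)]
    simp
  simp only [rowBoundSum, hmon, MvPolynomial.coeff_sum, MvPolynomial.coeff_monomial,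
    EmbeddingLike.apply_eq_iff_eq, Finset.card_filter]
  push_cast
  rfl

lemma exists_content_eq (h : rowBoundSum lam β = rowBoundSum lam η)
    {Y : (i : Fin n) → Fin (lam i) → Fin n} (hY : Y ∈ tableaux lam η) :
    ∃ T ∈ tableaux lam β, content T = content Y := by
  classical
  have hc := coeff_rowBoundSum lam β (content Y)
  rw [h, coeff_rowBoundSum, Nat.cast_inj] at hc
  have hpos : 0 < ((tableaux lam η).filter fun T => content T = content Y).card :=
    Finset.card_pos.2 ⟨Y, Finset.mem_filter.2 ⟨hY, rfl⟩⟩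
  rw [hc] at hpos
  obtain ⟨T, hT⟩ := Finset.card_pos.1 hpos
  exact ⟨T, (Finset.mem_filter.1 hT).1, (Finset.mem_filter.1 hT).2⟩

lemma card_tableaux_eq (h : rowBoundSum lam β = rowBoundSum lam η) :
    (tableaux lam β).card = (tableaux lam η).card := by
  have := congrArg (MvPolynomial.eval fun _ => (1 : ℤ)) h
  simpa [rowBoundSum] using this

/-- A row bound sum that equals a gapless core Schur polynomial has the same core. -/
lemma core_eq_of_rowBoundSum_eq (hlam : Antitone lam) (hβ : β ∈ U n)
    (hη : η ∈ UGC (dividers lam)) (h : rowBoundSum lam β = rowBoundSum lam η) :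
    core (dividers lam) β = core (dividers lam) η := by
  have hY := maxTableau_mem hlam hη.1
  obtain ⟨T, hT, hTY⟩ := exists_content_eq h hY
  have hnest : ∀ j j', j ≤ j' →
      colSet (maxTableau lam η) j' ⊆ colSet (maxTableau lam η) j := by
    intro j j' hjj' k hk
    obtain ⟨i, hi, rfl⟩ := mem_colSet.1 hk
    exact mem_colSet.2 (maxTableau_nested hlam hη hjj' i hi)
  obtain rfl := ((mem_tableaux hβ).1 hT).1.eq_of_content_eq ((mem_tableaux hη.1).1 hY).1 hnest hTY
  have hle := core_le_of_maxTableau_mem hlam hβ hη.1 hT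
  -- The inclusion is an equality by counting, so the largest tableau for `β` also obeys `η`.
  have heq := Finset.eq_of_subset_of_card_le (tableaux_subset hlam hβ hη.1 hle)
    (card_tableaux_eq h).le
  exact le_antisymm
    (core_le_of_maxTableau_mem hlam hη.1 hβ (heq ▸ maxTableau_mem hlam hβ)) hle

lemma rowBoundSum_eq_of_tableaux_eq (h : tableaux lam β = tableaux lam η) :
    rowBoundSum lam β = rowBoundSum lam η := by
  rw [rowBoundSum, rowBoundSum, h]

lemma rowBoundSum_eq_iff_core (hlam : Antitone lam) (hβ : β ∈ U n)
    (hη : η ∈ UGC (dividers lam)) :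
    rowBoundSum lam β = rowBoundSum lam η ↔ core (dividers lam) β = core (dividers lam) η :=
  ⟨core_eq_of_rowBoundSum_eq hlam hβ hη, fun h =>
    rowBoundSum_eq_of_tableaux_eq (tableaux_eq_of_core_eq hlam hβ hη.1 h)⟩

lemma rowBoundSum_eq_iff_equi (hlam : Antitone lam) (hβ : β ∈ U n)
    (hη : η ∈ UGC (dividers lam)) :
    rowBoundSum lam β = rowBoundSum lam η ↔ Equi (dividers lam) β η := by
  rw [rowBoundSum_eq_iff_core hlam hβ hη, equi_iff hβ hη.1]

lemma rowBoundSum_eq_iff_tableaux (hlam : Antitone lam) (hβ : β ∈ U n)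
    (hη : η ∈ UGC (dividers lam)) :
    rowBoundSum lam β = rowBoundSum lam η ↔ tableaux lam β = tableaux lam η :=
  ⟨fun h => tableaux_eq_of_core_eq hlam hβ hη.1 (core_eq_of_rowBoundSum_eq hlam hβ hη h),
    rowBoundSum_eq_of_tableaux_eq⟩

end Polynomial

/-! ### Inequivalence as disjointness of classes. -/

section Classes

variable {n : ℕ} {R : Set ℕ} {υ υ' φ φ' : Fin n → Fin n}

lemma not_equi_iff_disjoint_classU (hυ : υ ∈ U n) :
    ¬ Equi R υ υ' ↔ Disjoint (classU R υ) (classU R υ') := by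
  rw [Set.disjoint_left]
  refine ⟨fun h ε hε hε' => h (hε.2.symm.trans hε'.2), fun h he => h ⟨hυ, rfl⟩ ⟨hυ, he⟩⟩

lemma not_equi_iff_disjoint_classF (hφ : φ ∈ UF n) :
    ¬ Equi R φ φ' ↔ Disjoint (classF R φ) (classF R φ') := by
  rw [Set.disjoint_left]
  refine ⟨fun h ε hε hε' => h (hε.2.symm.trans hε'.2), fun h he => h ⟨hφ, rfl⟩ ⟨hφ, he⟩⟩

end Classes

end RowBound

theorem corollary10p4 (n : ℕ) [NeZero n] (lam : Fin n → ℕ) (hlam : Antitone lam) :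
    -- equality with a gapless core Schur polynomial is never accidental
    (∀ β ∈ RowBound.U n, ∀ η ∈ RowBound.UGC (RowBound.dividers lam),
      RowBound.rowBoundSum lam β = RowBound.rowBoundSum lam η →
        RowBound.Equi (RowBound.dividers lam) β η ∧
        β ∈ RowBound.UGC (RowBound.dividers lam) ∧
        RowBound.tableaux lam β = RowBound.tableaux lam η) ∧
    -- indexing ambiguity for gapless core Schur polynomials
    (∀ η ∈ RowBound.UGC (n := n) (RowBound.dividers lam),
      {η' | η' ∈ RowBound.UGC (RowBound.dividers lam) ∧
          RowBound.rowBoundSum lam η' = RowBound.rowBoundSum lam η} =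
        RowBound.classG (RowBound.dividers lam) η ∧
      RowBound.classG (RowBound.dividers lam) η = RowBound.classU (RowBound.dividers lam) η ∧
      RowBound.classG (RowBound.dividers lam) η =
        Set.Icc (RowBound.core (RowBound.dividers lam) η)
          (RowBound.canopy (RowBound.dividers lam) η) ∧
      IsLeast (RowBound.classG (RowBound.dividers lam) η)
        (RowBound.core (RowBound.dividers lam) η) ∧
      IsGreatest (RowBound.classG (RowBound.dividers lam) η)
        (RowBound.canopy (RowBound.dividers lam) η)) ∧
    -- equality and non-equality of gapless core Schur polynomials
    (∀ η ∈ RowBound.UGC (n := n) (RowBound.dividers lam),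
      ∀ η' ∈ RowBound.UGC (n := n) (RowBound.dividers lam),
      (RowBound.rowBoundSum lam η = RowBound.rowBoundSum lam η' ↔
        RowBound.Equi (RowBound.dividers lam) η η') ∧
      (RowBound.rowBoundSum lam η = RowBound.rowBoundSum lam η' ↔
        RowBound.tableaux lam η = RowBound.tableaux lam η') ∧
      (RowBound.rowBoundSum lam η ≠ RowBound.rowBoundSum lam η' ↔
        Disjoint
          (Set.Icc (RowBound.core (RowBound.dividers lam) η)
            (RowBound.canopy (RowBound.dividers lam) η))
          (Set.Icc (RowBound.core (RowBound.dividers lam) η')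
            (RowBound.canopy (RowBound.dividers lam) η')))) ∧
    -- indexing ambiguity for flag Schur polynomials
    (∀ φ ∈ RowBound.UF n,
      {φ' | φ' ∈ RowBound.UF n ∧
          RowBound.rowBoundSum lam φ' = RowBound.rowBoundSum lam φ} =
        RowBound.classF (RowBound.dividers lam) φ ∧
      RowBound.classF (RowBound.dividers lam) φ =
        RowBound.UF n ∩ Set.Icc (RowBound.floorFlag (RowBound.dividers lam) φ)
          (RowBound.ceilingFlag (RowBound.dividers lam) φ) ∧
      IsLeast (RowBound.classF (RowBound.dividers lam) φ)
        (RowBound.floorFlag (RowBound.dividers lam) φ) ∧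
      IsGreatest (RowBound.classF (RowBound.dividers lam) φ)
        (RowBound.ceilingFlag (RowBound.dividers lam) φ) ∧
      RowBound.classF (RowBound.dividers lam) φ ⊆
        Set.Icc (RowBound.core (RowBound.dividers lam) φ)
          (RowBound.canopy (RowBound.dividers lam) φ) ∧
      Set.Icc (RowBound.core (RowBound.dividers lam) φ)
          (RowBound.canopy (RowBound.dividers lam) φ) =
        RowBound.classU (RowBound.dividers lam) φ ∧
      RowBound.classU (RowBound.dividers lam) φ ⊆ RowBound.UGC (RowBound.dividers lam)) ∧
    -- equality and non-equality of flag Schur polynomials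
    (∀ φ ∈ RowBound.UF n, ∀ φ' ∈ RowBound.UF n,
      (RowBound.rowBoundSum lam φ = RowBound.rowBoundSum lam φ' ↔
        RowBound.Equi (RowBound.dividers lam) φ φ') ∧
      (RowBound.rowBoundSum lam φ = RowBound.rowBoundSum lam φ' ↔
        RowBound.tableaux lam φ = RowBound.tableaux lam φ') ∧
      (RowBound.rowBoundSum lam φ ≠ RowBound.rowBoundSum lam φ' ↔
        Disjoint
          (RowBound.UF n ∩ Set.Icc (RowBound.floorFlag (RowBound.dividers lam) φ)
            (RowBound.ceilingFlag (RowBound.dividers lam) φ))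
          (RowBound.UF n ∩ Set.Icc (RowBound.floorFlag (RowBound.dividers lam) φ')
            (RowBound.ceilingFlag (RowBound.dividers lam) φ')))) := by
  refine ⟨fun β hβ η hη h => ?_, fun η hη => ?_, fun η hη η' hη' => ?_, fun φ hφ => ?_,
    fun φ hφ φ' hφ' => ?_⟩
  · have hc := RowBound.core_eq_of_rowBoundSum_eq hlam hβ hη h
    exact ⟨(RowBound.equi_iff hβ hη.1).2 hc, RowBound.UGC_of_core_eq hβ hη hc,
      RowBound.tableaux_eq_of_core_eq hlam hβ hη.1 hc⟩
  · have hcl := RowBound.classG_eq_classU hη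
    rw [RowBound.classU_eq_Icc hη.1] at hcl
    refine ⟨?_, RowBound.classG_eq_classU hη, hcl, ?_, ?_⟩
    · apply Set.ext
      intro η'
      exact and_congr_right fun hη' => RowBound.rowBoundSum_eq_iff_equi hlam hη'.1 hη
    · rw [hcl]
      exact isLeast_Icc (RowBound.core_le_canopy hη.1)
    · rw [hcl]
      exact isGreatest_Icc (RowBound.core_le_canopy hη.1)
  · refine ⟨RowBound.rowBoundSum_eq_iff_equi hlam hη.1 hη',
      RowBound.rowBoundSum_eq_iff_tableaux hlam hη.1 hη', ?_⟩
    rw [Ne, RowBound.rowBoundSum_eq_iff_equi hlam hη.1 hη', ← RowBound.classU_eq_Icc hη.1,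
      ← RowBound.classU_eq_Icc hη'.1, RowBound.not_equi_iff_disjoint_classU hη.1]
  · have hcl := RowBound.classF_eq (R := RowBound.dividers lam) hφ
    have hU := RowBound.classU_eq_Icc (R := RowBound.dividers lam) hφ.1
    have hle := RowBound.floorFlag_le_ceilingFlag (R := RowBound.dividers lam) hφ
    refine ⟨?_, hcl, ?_, ?_, ?_, hU.symm,
      RowBound.classU_subset_UGC (RowBound.UF_subset_UGC hφ)⟩
    · apply Set.ext
      intro φ'
      exact and_congr_right fun hφ' =>
        RowBound.rowBoundSum_eq_iff_equi hlam hφ'.1 (RowBound.UF_subset_UGC hφ)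
    · rw [hcl]
      exact ⟨⟨RowBound.floorFlag_mem_UF hφ, le_rfl, hle⟩, fun _ h => h.2.1⟩
    · rw [hcl]
      exact ⟨⟨RowBound.ceilingFlag_mem_UF hφ, hle, le_rfl⟩, fun _ h => h.2.2⟩
    · rw [← hU]
      exact fun φ' h => ⟨h.1.1, h.2⟩
  · have hη' := RowBound.UF_subset_UGC (R := RowBound.dividers lam) hφ'
    refine ⟨RowBound.rowBoundSum_eq_iff_equi hlam hφ.1 hη',
      RowBound.rowBoundSum_eq_iff_tableaux hlam hφ.1 hη', ?_⟩
    rw [Ne, RowBound.rowBoundSum_eq_iff_equi hlam hφ.1 hη', ← RowBound.classF_eq hφ,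
      ← RowBound.classF_eq hφ', RowBound.not_equi_iff_disjoint_classF hφ]
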